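/- For a bounded measurable $2\pi$-periodic function $f$ on $\mathbb{R}$ and $n\in\mathbb{N}$, let $T_n(f)$ be the $n\times n$ Toeplitz matrix with entries $$(T_n(f))_{ij}=C_{i-j},\qquad C_k=\frac{1}{2\pi}\int_0^{2\pi} f(\theta)e^{-ik\theta}\,d\theta,\qquad 1\le i,j\le n.$$ Let $m\ge 0$, let $f_1,\dots,f_m:\mathbb{R}\to\mathbb{R}$ be $2\pi$-periodic $C^\infty$ functions with $f_j(\theta)>0$ for all $\theta$, and let $\epsilon_1,\dots,\epsilon_m\in\{1,-1\}$. Then every matrix $T_n(f_j)$ is invertible, and, as $n\to\infty$, $$\operatorname{Tr}\left(\prod_{j=1}^m T_n(f_j)^{\epsilon_j}\right)=\frac{n}{2\pi}\int_0^{2\pi}\prod_{j=1}^m f_j(\theta)^{\epsilon_j}\,d\theta+O(1),$$ where the matrix product is taken in the order $j=1,\dots,m$, and the constant in $O(1)$ may depend on $m$, the $f_j$ and the $\epsilon_j$, but not on $n$. -/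

import Mathlib

open scoped ContDiff

/-- The `k`-th Fourier coefficient `(1 / 2π) ∫₀^{2π} a(θ) e^{-ikθ} dθ` of a symbol `a`,
a `2π`-periodic function on the real line. -/
noncomputable def symbolCoeff (a : ℝ → ℂ) (k : ℤ) : ℂ :=
  (1 / (2 * (Real.pi : ℂ))) *
    ∫ θ in (0 : ℝ)..(2 * Real.pi), a θ * Complex.exp (-(Complex.I * (k : ℂ) * (θ : ℂ)))

/-- The `n × n` Toeplitz matrix `T_n(a)` with symbol `a`: its `(i, j)` entry is the Fourier
coefficient of `a` of index `i - j`. -/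
noncomputable def toeplitzMatrix (n : ℕ) (a : ℝ → ℂ) : Matrix (Fin n) (Fin n) ℂ :=
  Matrix.of fun i j => symbolCoeff a ((i : ℤ) - (j : ℤ))

/-!
Trace asymptotics for products of Toeplitz matrices and their inverses, for smooth positive symbols.

The idea is that `a ↦ T_n(a)` is multiplicative up to an error that stays bounded in trace norm as
`n → ∞`. The `(i, j)` entry of `T_n(ab)` is the full convolution `∑_p a_p b_{i-j-p}` of the Fourier
coefficients, whereas that of `T_n(a) T_n(b)` keeps only the `p` with `0 ≤ i - p < n`. For each `p`
at most `|p|` rows `i` are affected, so the entries of the difference have absolute sum at most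
`(∑ |p| |a_p|) (∑ |b_p|)`, which is finite for smooth symbols
(`traceNormBounded_toeplitzMatrix_mul_sub`).

For a symbol with `0 < δ ≤ g ≤ M`, the quadratic form of `T_n(g)` is an integral of `g` against a
nonnegative function, whence `δ ≤ T_n(g) ≤ M` in the Loewner order. So `T_n(g)` is invertible, with
`‖T_n(g)‖ ≤ M` and `‖T_n(g)⁻¹‖ ≤ δ⁻¹` (`norm_toeplitzMatrix_le`,
`isUnit_toeplitzMatrix_and_norm_inv_le`). Sequences bounded in trace norm absorb factors bounded in
operator norm, so `T_n(g)⁻¹ - T_n(g⁻¹) = T_n(g)⁻¹ (T_n(1) - T_n(g) T_n(g⁻¹))` is bounded in trace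
norm, and induction on the number of factors shows that the whole product differs from the Toeplitz
matrix of the product symbol by such a sequence
(`isPosSmoothSymbol_and_traceNormBounded_prod`). The trace of that Toeplitz matrix is `n` times the
mean of the symbol, and the trace of the error is `O(1)`.

The trace norm enters only through its duality with the operator norm, see `TraceNormBounded`.
-/

/-! ### Fourier coefficients of smooth periodic symbols -/

open Complex in
theorem symbolCoeff_deriv {a : ℝ → ℂ} (ha : Function.Periodic a (2 * Real.pi))
    (hs : ContDiff ℝ 1 a) (k : ℤ) :
    symbolCoeff (deriv a) k = I * k * symbolCoeff a k := by
  have hv (θ : ℝ) :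
      HasDerivAt (fun θ : ℝ => exp (-(I * k * θ))) (-(I * k) * exp (-(I * k * θ))) θ := by
    have h1 : HasDerivAt (fun θ : ℝ => -(I * k * (θ : ℂ))) (-(I * k)) θ := by
      simpa [Pi.neg_def] using ((hasDerivAt_id θ).ofReal_comp.const_mul (I * (k : ℂ))).neg
    simpa [mul_comm] using h1.cexp
  have hu (θ : ℝ) : HasDerivAt a (deriv a θ) θ := (hs.differentiable (by simp) θ).hasDerivAt
  have hc : Continuous (deriv a) := hs.continuous_deriv le_rfl
  have hp := intervalIntegral.integral_mul_deriv_eq_deriv_mul (a := 0) (b := 2 * Real.pi)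
    (fun x _ => hu x) (fun x _ => hv x) (hc.intervalIntegrable _ _)
    (Continuous.intervalIntegrable (by fun_prop) _ _)
  have hperiod : exp (-(I * k * ((2 * Real.pi : ℝ) : ℂ))) = 1 := by
    rw [Complex.exp_eq_one_iff]
    exact ⟨-k, by push_cast; ring⟩
  have ha0 : a (2 * Real.pi) = a 0 := by simpa using ha 0
  rw [hperiod, ha0] at hp
  simp only [ofReal_zero, mul_zero, neg_zero, exp_zero, sub_self, zero_sub] at hp
  have hl : ∫ θ in (0 : ℝ)..(2 * Real.pi), a θ * (-(I * k) * exp (-(I * k * θ)))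
      = -(I * k) * ∫ θ in (0 : ℝ)..(2 * Real.pi), a θ * exp (-(I * k * θ)) := by
    rw [← intervalIntegral.integral_const_mul]
    congr 1; ext θ; ring
  rw [hl] at hp
  unfold symbolCoeff
  linear_combination (1 / (2 * (Real.pi : ℂ))) * hp

theorem norm_symbolCoeff_le {a : ℝ → ℂ} {M : ℝ} (h : ∀ θ, ‖a θ‖ ≤ M) (k : ℤ) :
    ‖symbolCoeff a k‖ ≤ M := by
  have h1 : ‖∫ θ in (0 : ℝ)..(2 * Real.pi),
      a θ * Complex.exp (-(Complex.I * (k : ℂ) * (θ : ℂ)))‖ ≤ M * |2 * Real.pi - 0| := by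
    refine intervalIntegral.norm_integral_le_of_norm_le_const fun θ _ => ?_
    have : ‖Complex.exp (-(Complex.I * (k : ℂ) * (θ : ℂ)))‖ = 1 := by
      rw [Complex.norm_exp]; simp
    rw [norm_mul, this, mul_one]
    exact h θ
  have hpi := Real.pi_pos
  rw [sub_zero, abs_of_pos (by positivity)] at h1
  have h2 : ‖(1 / (2 * (Real.pi : ℂ)))‖ = 1 / (2 * Real.pi) := by
    simp [abs_of_pos hpi]
  rw [symbolCoeff, norm_mul, h2]
  calc _ ≤ 1 / (2 * Real.pi) * (M * (2 * Real.pi)) := by gcongr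
    _ = M := by field_simp

theorem exists_norm_le_of_periodic {E : Type*} [SeminormedAddCommGroup E] {a : ℝ → E}
    (ha : Function.Periodic a (2 * Real.pi)) (hc : Continuous a) :
    ∃ M, ∀ θ, ‖a θ‖ ≤ M := by
  obtain ⟨M, hM⟩ := (isCompact_Icc (a := (0 : ℝ)) (b := 2 * Real.pi)).exists_bound_of_continuousOn
    hc.continuousOn
  refine ⟨M, fun θ => ?_⟩
  obtain ⟨y, hy, h⟩ := ha.exists_mem_Ico₀ (by positivity) θ
  rw [h]
  exact hM y ⟨hy.1, hy.2.le⟩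

theorem Function.Periodic.deriv {E : Type*} [NormedAddCommGroup E] [NormedSpace ℝ E]
    {a : ℝ → E} {c : ℝ} (ha : Function.Periodic a c) : Function.Periodic (deriv a) c := by
  intro θ
  rw [← deriv_comp_add_const]
  congr 1
  exact funext ha

/-- Three integrations by parts give `c_k = O(|k|⁻³)`, hence `∑ |k| |c_k| < ∞`. -/
theorem summable_abs_mul_norm_symbolCoeff {a : ℝ → ℂ} (ha : Function.Periodic a (2 * Real.pi))
    (hs : ContDiff ℝ ∞ a) : Summable fun k : ℤ => |(k : ℝ)| * ‖symbolCoeff a k‖ := by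
  have h1 : ContDiff ℝ ∞ (deriv a) := (contDiff_infty_iff_deriv.1 hs).2
  have h2 : ContDiff ℝ ∞ (deriv (deriv a)) := (contDiff_infty_iff_deriv.1 h1).2
  have h3 : ContDiff ℝ ∞ (deriv (deriv (deriv a))) := (contDiff_infty_iff_deriv.1 h2).2
  obtain ⟨M, hM⟩ := exists_norm_le_of_periodic ha.deriv.deriv.deriv h3.continuous
  have hle (k : ℤ) : |(k : ℝ)| ^ 3 * ‖symbolCoeff a k‖ ≤ M := by
    have := norm_symbolCoeff_le hM k
    rw [symbolCoeff_deriv ha.deriv.deriv (h2.of_le (by simp)),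
      symbolCoeff_deriv ha.deriv (h1.of_le (by simp)),
      symbolCoeff_deriv ha (hs.of_le (by simp))] at this
    simp only [norm_mul, Complex.norm_I, one_mul, Complex.norm_intCast] at this
    linarith
  refine Summable.of_nonneg_of_le (fun k => by positivity) (fun k => ?_)
    ((Real.summable_one_div_int_pow (p := 2)).2 (by norm_num) |>.mul_left M)
  rcases eq_or_ne k 0 with rfl | hk
  · simp
  · have hk' : 0 < |(k : ℝ)| := by positivity
    rw [← sq_abs, mul_one_div, le_div_iff₀ (by positivity)]
    linarith [hle k]

theorem summable_norm_symbolCoeff {a : ℝ → ℂ} (ha : Function.Periodic a (2 * Real.pi))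
    (hs : ContDiff ℝ ∞ a) : Summable fun k : ℤ => ‖symbolCoeff a k‖ := by
  refine ((summable_abs_mul_norm_symbolCoeff ha hs).add
    (hasSum_ite_eq (0 : ℤ) ‖symbolCoeff a 0‖).summable).of_nonneg_of_le
    (fun k => norm_nonneg _) fun k => ?_
  rcases eq_or_ne k 0 with rfl | hk
  · simp
  · simp only [hk, if_false, add_zero]
    have : (1 : ℝ) ≤ |(k : ℝ)| := by exact_mod_cast Int.one_le_abs hk
    nlinarith [norm_nonneg (symbolCoeff a k)]

/-- A smooth periodic symbol is the sum of its Fourier series at every point. -/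
theorem hasSum_symbolCoeff_mul_exp {a : ℝ → ℂ} (ha : Function.Periodic a (2 * Real.pi))
    (hs : ContDiff ℝ ∞ a) (θ : ℝ) :
    HasSum (fun k : ℤ => symbolCoeff a k * Complex.exp (Complex.I * k * θ)) (a θ) := by
  have : Fact (0 < 2 * Real.pi) := ⟨by positivity⟩
  have hc : Continuous (ha.lift : AddCircle (2 * Real.pi) → ℂ) :=
    continuous_coinduced_dom.2 hs.continuous
  let F : C(AddCircle (2 * Real.pi), ℂ) := ⟨ha.lift, hc⟩
  have hF (x : ℝ) : F (x : AddCircle (2 * Real.pi)) = a x := ha.lift_coe x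
  have he (k : ℤ) (x : ℝ) : fourier k (x : AddCircle (2 * Real.pi)) =
      Complex.exp (Complex.I * k * x) := by
    rw [fourier_coe_apply]
    congr 1
    push_cast
    field_simp [Real.pi_ne_zero]
  have hcoeff (k : ℤ) : fourierCoeff F k = symbolCoeff a k := by
    rw [fourierCoeff_eq_intervalIntegral _ _ 0, zero_add, symbolCoeff, Complex.real_smul]
    congr 1
    · push_cast; rfl
    · congr 1; ext x
      rw [hF, he, smul_eq_mul, mul_comm]
      push_cast; ring_nf
  have hsum : Summable (fourierCoeff F) := by
    refine Summable.of_norm ?_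
    simpa only [hcoeff] using summable_norm_symbolCoeff ha hs
  have := has_pointwise_sum_fourier_series_of_summable hsum (θ : AddCircle (2 * Real.pi))
  simpa only [hcoeff, he, hF, smul_eq_mul] using this

/-- The Fourier coefficients of a product are the convolution of the Fourier coefficients. -/
theorem hasSum_symbolCoeff_mul {a b : ℝ → ℂ} (ha : Function.Periodic a (2 * Real.pi))
    (hs : ContDiff ℝ ∞ a) (hb : Function.Periodic b (2 * Real.pi)) (hbc : Continuous b) (k : ℤ) :
    HasSum (fun p : ℤ => symbolCoeff a p * symbolCoeff b (k - p))
      (symbolCoeff (fun θ => a θ * b θ) k) := by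
  obtain ⟨M, hM⟩ := exists_norm_le_of_periodic hb hbc
  have hn (x : ℝ) (p : ℤ) : ‖Complex.exp (Complex.I * p * x)‖ = 1 := by
    rw [Complex.norm_exp]; simp
  have key := intervalIntegral.hasSum_integral_of_dominated_convergence
    (μ := MeasureTheory.volume) (a := (0 : ℝ)) (b := 2 * Real.pi)
    (F := fun (p : ℤ) θ => symbolCoeff a p * Complex.exp (Complex.I * p * θ) *
      (b θ * Complex.exp (-(Complex.I * k * θ))))
    (f := fun θ => a θ * (b θ * Complex.exp (-(Complex.I * k * θ))))
    (bound := fun p _ => ‖symbolCoeff a p‖ * M)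
    (fun p => Continuous.aestronglyMeasurable (by fun_prop))
    (fun p => Filter.Eventually.of_forall fun θ _ => by
      have h2 := hn θ (-k)
      push_cast at h2
      rw [mul_neg, neg_mul] at h2
      rw [norm_mul, norm_mul, norm_mul, hn, h2, mul_one, mul_one]
      gcongr
      exact hM θ)
    (Filter.Eventually.of_forall fun θ _ => (summable_norm_symbolCoeff ha hs).mul_right M)
    (by simp)
    (Filter.Eventually.of_forall fun θ _ => (hasSum_symbolCoeff_mul_exp ha hs θ).mul_right _)
  convert! key.mul_left (1 / (2 * (Real.pi : ℂ))) using 1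
  · ext p
    have : ∫ θ in (0 : ℝ)..(2 * Real.pi), symbolCoeff a p * Complex.exp (Complex.I * p * θ) *
        (b θ * Complex.exp (-(Complex.I * k * θ))) = symbolCoeff a p *
        ∫ θ in (0 : ℝ)..(2 * Real.pi), b θ * Complex.exp (-(Complex.I * (k - p : ℤ) * θ)) := by
      rw [← intervalIntegral.integral_const_mul]
      congr 1; ext θ
      have : Complex.exp (-(Complex.I * (k - p : ℤ) * θ)) =
          Complex.exp (Complex.I * p * θ) * Complex.exp (-(Complex.I * k * θ)) := by
        rw [← Complex.exp_add]; push_cast; ring_nf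
      rw [this]; ring
    rw [this]
    simp only [symbolCoeff]
    ring
  · rw [symbolCoeff]
    simp only [mul_assoc]

theorem symbolCoeff_const (c : ℂ) (k : ℤ) :
    symbolCoeff (fun _ => c) k = if k = 0 then c else 0 := by
  split_ifs with hk
  · subst hk
    have := Real.pi_ne_zero
    simp [symbolCoeff]
    field_simp
  · -- the derivative formula reads `0 = I k c_k`
    have := symbolCoeff_deriv (a := fun _ => c) (fun _ => rfl) contDiff_const k
    rw [show deriv (fun _ : ℝ => c) = fun _ => 0 from funext fun _ => deriv_const _ _] at this
    have h0 : symbolCoeff (fun _ => 0) k = 0 := by simp [symbolCoeff]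
    rw [h0, eq_comm, mul_eq_zero] at this
    simpa [hk] using this

theorem symbolCoeff_sub {a b : ℝ → ℂ} (ha : Continuous a) (hb : Continuous b) (k : ℤ) :
    symbolCoeff (fun θ => a θ - b θ) k = symbolCoeff a k - symbolCoeff b k := by
  simp only [symbolCoeff, sub_mul]
  rw [intervalIntegral.integral_sub (Continuous.intervalIntegrable (by fun_prop) _ _)
    (Continuous.intervalIntegrable (by fun_prop) _ _), mul_sub]

open scoped ComplexOrder

/-! ### Norm bounds for Toeplitz matrices of positive symbols -/

open Matrix in
/-- The quadratic form of `T_n(a)` at `x` is the mean of `a |p_x|²`, where `p_x` is the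
trigonometric polynomial `∑ x_j e^{ijθ}`. -/
theorem star_dotProduct_toeplitzMatrix_mulVec (n : ℕ) {a : ℝ → ℂ} (ha : Continuous a)
    (x : Fin n → ℂ) :
    star x ⬝ᵥ (toeplitzMatrix n a *ᵥ x) = (1 / (2 * (Real.pi : ℂ))) *
      ∫ θ in (0 : ℝ)..(2 * Real.pi), a θ *
        (Complex.normSq (∑ j, x j * Complex.exp (Complex.I * (j : ℕ) * θ)) : ℂ) := by
  have h1 (θ : ℝ) : a θ *
        (Complex.normSq (∑ j, x j * Complex.exp (Complex.I * (j : ℕ) * θ)) : ℂ) =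
      ∑ i, ∑ j, star (x i) * x j *
        (a θ * Complex.exp (-(Complex.I * ((i : ℤ) - (j : ℤ) : ℤ) * θ))) := by
    rw [Complex.normSq_eq_conj_mul_self, map_sum, Finset.sum_mul_sum, Finset.mul_sum]
    refine Finset.sum_congr rfl fun i _ => ?_
    rw [Finset.mul_sum]
    refine Finset.sum_congr rfl fun j _ => ?_
    have : Complex.exp (-(Complex.I * ((i : ℤ) - (j : ℤ) : ℤ) * θ)) =
        (starRingEnd ℂ) (Complex.exp (Complex.I * (i : ℕ) * θ)) *
          Complex.exp (Complex.I * (j : ℕ) * θ) := by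
      rw [← Complex.exp_conj, ← Complex.exp_add]
      simp only [map_mul, Complex.conj_I, Complex.conj_ofReal, map_natCast]
      push_cast; ring_nf
    rw [this, map_mul]
    simp only [Complex.star_def]
    ring
  simp_rw [h1]
  rw [intervalIntegral.integral_finsetSum fun i _ =>
    Continuous.intervalIntegrable (by fun_prop) _ _, Finset.mul_sum]
  simp only [dotProduct, mulVec, Finset.mul_sum, Pi.star_apply]
  refine Finset.sum_congr rfl fun i _ => ?_
  rw [intervalIntegral.integral_finsetSum fun i _ =>
    Continuous.intervalIntegrable (by fun_prop) _ _, Finset.mul_sum]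
  refine Finset.sum_congr rfl fun j _ => ?_
  rw [intervalIntegral.integral_const_mul]
  simp only [toeplitzMatrix, of_apply, symbolCoeff]
  ring

theorem posSemidef_toeplitzMatrix (n : ℕ) {g : ℝ → ℝ} (hg : Continuous g) (h0 : ∀ θ, 0 ≤ g θ) :
    (toeplitzMatrix n fun θ => (g θ : ℂ)).PosSemidef := by
  refine Matrix.PosSemidef.of_dotProduct_mulVec_nonneg ?_ fun x => ?_
  · ext i j
    simp only [Matrix.conjTranspose_apply, toeplitzMatrix, Matrix.of_apply, symbolCoeff, star_mul',
      Complex.star_def]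
    congr 1
    · simp [map_ofNat]
    · rw [intervalIntegral.integral_of_le (by positivity),
        intervalIntegral.integral_of_le (by positivity), ← integral_conj]
      congr 1; ext θ
      rw [map_mul, ← Complex.exp_conj]
      simp only [map_neg, map_mul, Complex.conj_I, Complex.conj_ofReal, map_intCast]
      push_cast; ring_nf
  · rw [star_dotProduct_toeplitzMatrix_mulVec n (by fun_prop)]
    have : ∀ θ : ℝ, (g θ : ℂ) *
        (Complex.normSq (∑ j, x j * Complex.exp (Complex.I * (j : ℕ) * θ)) : ℂ) =
        ((g θ * Complex.normSq (∑ j, x j * Complex.exp (Complex.I * (j : ℕ) * θ)) : ℝ) : ℂ) := by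
      intro θ; push_cast; rfl
    simp_rw [this]
    rw [intervalIntegral.integral_ofReal]
    have hI : 0 ≤ ∫ θ in (0 : ℝ)..(2 * Real.pi),
        g θ * Complex.normSq (∑ j, x j * Complex.exp (Complex.I * (j : ℕ) * θ)) :=
      intervalIntegral.integral_nonneg (by positivity) fun θ _ =>
        mul_nonneg (h0 θ) (Complex.normSq_nonneg _)
    have : (0 : ℝ) ≤ 1 / (2 * Real.pi) *  ∫ θ in (0 : ℝ)..(2 * Real.pi),
        g θ * Complex.normSq (∑ j, x j * Complex.exp (Complex.I * (j : ℕ) * θ)) := by positivity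
    exact_mod_cast this

theorem toeplitzMatrix_const (n : ℕ) (c : ℂ) :
    toeplitzMatrix n (fun _ => c) = algebraMap ℂ (Matrix (Fin n) (Fin n) ℂ) c := by
  ext i j
  rw [Matrix.algebraMap_matrix_apply, toeplitzMatrix, Matrix.of_apply, symbolCoeff_const]
  congr 1
  rw [sub_eq_zero, Nat.cast_inj, Fin.val_inj]

theorem toeplitzMatrix_sub (n : ℕ) {a b : ℝ → ℂ} (ha : Continuous a) (hb : Continuous b) :
    toeplitzMatrix n (fun θ => a θ - b θ) = toeplitzMatrix n a - toeplitzMatrix n b := by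
  ext i j
  exact symbolCoeff_sub ha hb _

theorem trace_toeplitzMatrix (n : ℕ) (a : ℝ → ℂ) :
    (toeplitzMatrix n a).trace = n * symbolCoeff a 0 := by
  simp [Matrix.trace, toeplitzMatrix]

open scoped Matrix.Norms.L2Operator MatrixOrder

theorem toeplitzMatrix_mono (n : ℕ) {g h : ℝ → ℝ} (hg : Continuous g) (hh : Continuous h)
    (hgh : ∀ θ, g θ ≤ h θ) :
    toeplitzMatrix n (fun θ => (g θ : ℂ)) ≤ toeplitzMatrix n (fun θ => (h θ : ℂ)) := by
  rw [Matrix.le_iff, ← toeplitzMatrix_sub n (by fun_prop) (by fun_prop)]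
  convert! posSemidef_toeplitzMatrix n (hh.sub hg) fun θ => sub_nonneg.2 (hgh θ) using 2
  ext θ; simp

theorem toeplitzMatrix_ofReal_const (n : ℕ) (c : ℝ) :
    toeplitzMatrix n (fun _ => (c : ℂ)) = algebraMap ℝ (Matrix (Fin n) (Fin n) ℂ) c := by
  rw [toeplitzMatrix_const]; rfl

/-- `0 ≤ g ≤ M` gives `0 ≤ T_n(g) ≤ M` in the Loewner order. -/
theorem norm_toeplitzMatrix_le (n : ℕ) {g : ℝ → ℝ} {M : ℝ} (hg : Continuous g) (h0 : ∀ θ, 0 ≤ g θ)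
    (hM : ∀ θ, g θ ≤ M) : ‖toeplitzMatrix n (fun θ => (g θ : ℂ))‖ ≤ M := by
  rw [CStarAlgebra.norm_le_iff_le_algebraMap _ ((h0 0).trans (hM 0))
    (posSemidef_toeplitzMatrix n hg h0).nonneg, ← toeplitzMatrix_ofReal_const]
  exact toeplitzMatrix_mono n hg continuous_const hM

/-- A matrix bounded below by a positive scalar is invertible, and its inverse is bounded above by
the inverse scalar. -/
theorem Matrix.isUnit_and_norm_inv_le_of_algebraMap_le {ι : Type*} [Fintype ι] [DecidableEq ι]
    {T : Matrix ι ι ℂ} {δ : ℝ} (hδ : 0 < δ) (h : algebraMap ℝ _ δ ≤ T) :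
    IsUnit T ∧ ‖T⁻¹‖ ≤ δ⁻¹ := by
  have h0 : (0 : Matrix ι ι ℂ) ≤ algebraMap ℝ _ δ := algebraMap_nonneg _ hδ.le
  let d : (Matrix ι ι ℂ)ˣ := Units.map (algebraMap ℝ (Matrix ι ι ℂ)).toMonoidHom
    (Units.mk0 δ hδ.ne')
  have hd : (d : Matrix ι ι ℂ) = algebraMap ℝ _ δ := rfl
  have hd' : ((d⁻¹ : (Matrix ι ι ℂ)ˣ) : Matrix ι ι ℂ) = algebraMap ℝ _ δ⁻¹ := rfl
  have hu : IsUnit T := CStarAlgebra.isUnit_of_le _ h (IsUnit.isStrictlyPositive d.isUnit h0)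
  refine ⟨hu, ?_⟩
  obtain ⟨t, rfl⟩ := hu
  have key := CStarAlgebra.inv_le_inv (a := d) (b := t) h0 h
  rw [hd'] at key
  rw [← Matrix.coe_units_inv]
  refine (CStarAlgebra.norm_le_iff_le_algebraMap _ (by positivity) ?_).2 key
  rw [Matrix.coe_units_inv]
  exact (Matrix.nonneg_iff_posSemidef.1 (h0.trans h)).inv.nonneg

theorem isUnit_toeplitzMatrix_and_norm_inv_le (n : ℕ) {g : ℝ → ℝ} {δ : ℝ} (hg : Continuous g)
    (hδ : 0 < δ) (h : ∀ θ, δ ≤ g θ) :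
    IsUnit (toeplitzMatrix n fun θ => (g θ : ℂ)) ∧
      ‖(toeplitzMatrix n fun θ => (g θ : ℂ))⁻¹‖ ≤ δ⁻¹ := by
  refine Matrix.isUnit_and_norm_inv_le_of_algebraMap_le hδ ?_
  rw [← toeplitzMatrix_ofReal_const]
  exact toeplitzMatrix_mono n continuous_const hg h

/-! ### Sequences of matrices bounded in trace norm -/

/-- The sequence `A` of matrices is bounded in operator norm. -/
def OpNormBounded (A : ∀ n : ℕ, Matrix (Fin n) (Fin n) ℂ) : Prop :=
  ∃ M : ℝ, 0 ≤ M ∧ ∀ n, ‖A n‖ ≤ M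

/-- The sequence `A` of matrices is bounded in trace norm, the trace norm being expressed through
its duality with the operator norm: `‖A‖₁ ≤ C` means that `|tr (A B)| ≤ C ‖B‖` for all `B`. -/
def TraceNormBounded (A : ∀ n : ℕ, Matrix (Fin n) (Fin n) ℂ) : Prop :=
  ∃ C : ℝ, 0 ≤ C ∧ ∀ n (B : Matrix (Fin n) (Fin n) ℂ), ‖(A n * B).trace‖ ≤ C * ‖B‖

namespace TraceNormBounded

variable {A B : ∀ n : ℕ, Matrix (Fin n) (Fin n) ℂ}

theorem zero : TraceNormBounded fun _ => 0 := ⟨0, le_rfl, fun n B => by simp⟩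

theorem add (hA : TraceNormBounded A) (hB : TraceNormBounded B) :
    TraceNormBounded fun n => A n + B n := by
  obtain ⟨C, hC, h⟩ := hA
  obtain ⟨D, hD, h'⟩ := hB
  refine ⟨C + D, by positivity, fun n X => ?_⟩
  rw [add_mul, Matrix.trace_add, add_mul C]
  exact (norm_add_le _ _).trans (add_le_add (h n X) (h' n X))

theorem neg (hA : TraceNormBounded A) : TraceNormBounded fun n => -A n := by
  obtain ⟨C, hC, h⟩ := hA
  exact ⟨C, hC, fun n X => by simpa [neg_mul] using h n X⟩

theorem mul_left (hA : TraceNormBounded A) (hB : OpNormBounded B) :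
    TraceNormBounded fun n => B n * A n := by
  obtain ⟨C, hC, h⟩ := hA
  obtain ⟨M, hM, h'⟩ := hB
  refine ⟨C * M, by positivity, fun n X => ?_⟩
  rw [mul_assoc, Matrix.trace_mul_comm, mul_assoc]
  refine (h n _).trans ?_
  rw [mul_assoc, mul_comm M]
  gcongr
  exact (norm_mul_le _ _).trans (by gcongr; exact h' n)

theorem mul_right (hA : TraceNormBounded A) (hB : OpNormBounded B) :
    TraceNormBounded fun n => A n * B n := by
  obtain ⟨C, hC, h⟩ := hA
  obtain ⟨M, hM, h'⟩ := hB
  refine ⟨C * M, by positivity, fun n X => ?_⟩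
  rw [mul_assoc]
  refine (h n _).trans ?_
  rw [mul_assoc]
  gcongr
  exact (norm_mul_le _ _).trans (by gcongr; exact h' n)

theorem exists_norm_trace_le (hA : TraceNormBounded A) : ∃ C, ∀ n, ‖(A n).trace‖ ≤ C := by
  obtain ⟨C, hC, h⟩ := hA
  refine ⟨C, fun n => ?_⟩
  have h1 : ‖(1 : Matrix (Fin n) (Fin n) ℂ)‖ ≤ 1 := by
    rw [← Matrix.diagonal_one, Matrix.l2_opNorm_diagonal]
    exact (pi_norm_le_iff_of_nonneg zero_le_one).2 fun _ => by simp
  simpa using (h n 1).trans (mul_le_of_le_one_right hC h1)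

end TraceNormBounded

theorem Matrix.norm_apply_le_l2_opNorm {ι : Type*} [Fintype ι] [DecidableEq ι]
    (B : Matrix ι ι ℂ) (i j : ι) : ‖B i j‖ ≤ ‖B‖ := by
  have h := Matrix.l2_opNorm_mulVec B (EuclideanSpace.single j (1 : ℂ))
  have h2 := PiLp.norm_apply_le ((EuclideanSpace.equiv ι ℂ).symm
    (B.mulVec (EuclideanSpace.single j (1 : ℂ)).ofLp)) i
  simpa using h2.trans h

/-- The trace norm is at most the sum of the absolute values of the entries. -/
theorem TraceNormBounded.of_sum_norm_le {A : ∀ n : ℕ, Matrix (Fin n) (Fin n) ℂ} {C : ℝ}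
    (hA : ∀ n, ∑ i, ∑ j, ‖A n i j‖ ≤ C) : TraceNormBounded A := by
  refine ⟨C, (by simpa using hA 0), fun n B => ?_⟩
  calc ‖(A n * B).trace‖ ≤ ∑ i, ∑ j, ‖A n i j‖ * ‖B‖ := by
        simp only [Matrix.trace, Matrix.diag_apply, Matrix.mul_apply]
        refine (norm_sum_le _ _).trans (Finset.sum_le_sum fun i _ =>
          (norm_sum_le _ _).trans (Finset.sum_le_sum fun j _ => ?_))
        rw [norm_mul]
        gcongr
        exact B.norm_apply_le_l2_opNorm j i
    _ = (∑ i, ∑ j, ‖A n i j‖) * ‖B‖ := by simp_rw [Finset.sum_mul]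
    _ ≤ C * ‖B‖ := by gcongr; exact hA n

/-! ### Products of Toeplitz matrices -/

/-- The number of `i ∈ [0, n)` whose translate `i - p` leaves `[0, n)` is at most `|p|`. -/
theorem card_filter_sub_notMem_le (n : ℕ) (p : ℤ) :
    (Finset.univ.filter fun i : Fin n => (i : ℤ) - p ∉ Finset.Ico (0 : ℤ) n).card ≤ p.natAbs := by
  rcases le_total 0 p with hp | hp
  · have := Finset.card_le_card_of_injOn (s := Finset.univ.filter fun i : Fin n =>
      (i : ℤ) - p ∉ Finset.Ico (0 : ℤ) n) (t := Finset.Ico (0 : ℤ) p) (fun i => (i : ℤ))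
      (fun i hi => by
        have := i.2
        simp at hi ⊢
        omega) (fun i _ j _ h => by simpa [Fin.ext_iff] using h)
    rw [Int.card_Ico] at this
    omega
  · have := Finset.card_le_card_of_injOn (s := Finset.univ.filter fun i : Fin n =>
      (i : ℤ) - p ∉ Finset.Ico (0 : ℤ) n) (t := Finset.Ico ((n : ℤ) + p) n) (fun i => (i : ℤ))
      (fun i hi => by
        have := i.2
        simp at hi ⊢
        omega) (fun i _ j _ h => by simpa [Fin.ext_iff] using h)
    rw [Int.card_Ico] at this
    omega

/-- The entries of `T_n(ab) - T_n(a) T_n(b)` are the part of the convolution of the Fourier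
coefficients in which the intermediate index `i - p` lies outside `[0, n)`. -/
theorem hasSum_toeplitzMatrix_mul_sub {a b : ℝ → ℂ} (ha : Function.Periodic a (2 * Real.pi))
    (has : ContDiff ℝ ∞ a) (hb : Function.Periodic b (2 * Real.pi)) (hbc : Continuous b)
    (n : ℕ) (i j : Fin n) :
    HasSum (fun p : ℤ => if (i : ℤ) - p ∈ Finset.Ico (0 : ℤ) n then 0 else
        symbolCoeff a p * symbolCoeff b ((i : ℤ) - j - p))
      ((toeplitzMatrix n (fun θ => a θ * b θ) - toeplitzMatrix n a * toeplitzMatrix n b) i j) := by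
  let e : Fin n ↪ ℤ := ⟨fun l => (i : ℤ) - l, fun l l' h => by simpa [Fin.ext_iff] using h⟩
  have he (l : Fin n) : e l = (i : ℤ) - l := rfl
  have hmem (p : ℤ) : p ∈ Finset.univ.map e ↔ (i : ℤ) - p ∈ Finset.Ico (0 : ℤ) n := by
    simp only [Finset.mem_map, Finset.mem_univ, true_and, he, Finset.mem_Ico]
    constructor
    · rintro ⟨l, rfl⟩
      have := l.2
      omega
    · rintro ⟨h1, h2⟩
      exact ⟨⟨((i : ℤ) - p).toNat, by omega⟩, by dsimp only; omega⟩
  have hfin : HasSum (fun p : ℤ => if (i : ℤ) - p ∈ Finset.Ico (0 : ℤ) n then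
      symbolCoeff a p * symbolCoeff b ((i : ℤ) - j - p) else 0)
      ((toeplitzMatrix n a * toeplitzMatrix n b) i j) := by
    convert! hasSum_sum_of_ne_finset_zero (L := .unconditional ℤ) (s := Finset.univ.map e)
      (f := fun p : ℤ => if (i : ℤ) - p ∈ Finset.Ico (0 : ℤ) n then
        symbolCoeff a p * symbolCoeff b ((i : ℤ) - j - p) else 0)
      (fun p hp => if_neg fun h => hp ((hmem p).2 h)) using 1
    rw [Finset.sum_map, Matrix.mul_apply]
    refine Finset.sum_congr rfl fun l _ => ?_
    rw [if_pos ((hmem _).1 (Finset.mem_map_of_mem e (Finset.mem_univ l)))]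
    simp only [toeplitzMatrix, Matrix.of_apply, he]
    congr 2
    ring
  refine ((hasSum_symbolCoeff_mul ha has hb hbc ((i : ℤ) - j)).sub hfin).congr_fun ?_
  intro p
  split_ifs <;> simp

/-- Multiplicativity of `a ↦ T_n(a)` up to an error bounded in trace norm: the entries of the error
have absolute sum at most `(∑ |p| |a_p|) (∑ |b_p|)`. -/
theorem traceNormBounded_toeplitzMatrix_mul_sub {a b : ℝ → ℂ}
    (ha : Function.Periodic a (2 * Real.pi)) (has : ContDiff ℝ ∞ a)
    (hb : Function.Periodic b (2 * Real.pi)) (hbs : ContDiff ℝ ∞ b) :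
    TraceNormBounded fun n =>
      toeplitzMatrix n (fun θ => a θ * b θ) - toeplitzMatrix n a * toeplitzMatrix n b := by
  have hsa := summable_norm_symbolCoeff ha has
  have hsa' := summable_abs_mul_norm_symbolCoeff ha has
  have hsb := summable_norm_symbolCoeff hb hbs
  set S := ∑' k : ℤ, ‖symbolCoeff b k‖ with hS
  have hS0 : 0 ≤ S := tsum_nonneg fun _ => norm_nonneg _
  refine .of_sum_norm_le (C := (∑' p : ℤ, |(p : ℝ)| * ‖symbolCoeff a p‖) * S) fun n => ?_
  -- the absolute value of the `p`-th term of the `(i, j)` entry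
  let F (i j : Fin n) (p : ℤ) : ℝ := if (i : ℤ) - p ∈ Finset.Ico (0 : ℤ) n then 0 else
    ‖symbolCoeff a p‖ * ‖symbolCoeff b ((i : ℤ) - j - p)‖
  have hF (i j : Fin n) : Summable (F i j) := by
    refine (hsa.mul_right S).of_nonneg_of_le (fun p => ?_) (fun p => ?_)
    · simp only [F]; split_ifs <;> positivity
    · simp only [F]
      split_ifs
      · positivity
      · gcongr
        exact hsb.le_tsum _ fun _ _ => norm_nonneg _
  have hentry (i j : Fin n) : ‖(toeplitzMatrix n (fun θ => a θ * b θ) -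
      toeplitzMatrix n a * toeplitzMatrix n b) i j‖ ≤ ∑' p, F i j p := by
    rw [← (hasSum_toeplitzMatrix_mul_sub ha has hb hbs.continuous n i j).tsum_eq]
    refine tsum_of_norm_bounded (hF i j).hasSum fun p => ?_
    simp only [F]
    split_ifs <;> simp
  have hcol (i : Fin n) (p : ℤ) : ∑ j : Fin n, ‖symbolCoeff b ((i : ℤ) - j - p)‖ ≤ S := by
    let e : Fin n ↪ ℤ := ⟨fun j => (i : ℤ) - j - p, fun l l' h => by
      simpa [Fin.ext_iff] using h⟩
    have := hsb.sum_le_tsum (Finset.univ.map e) fun _ _ => norm_nonneg _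
    rwa [Finset.sum_map] at this
  calc _ ≤ ∑ i, ∑ j, ∑' p, F i j p :=
        Finset.sum_le_sum fun i _ => Finset.sum_le_sum fun j _ => hentry i j
    _ = ∑' p, ∑ i, ∑ j, F i j p := by
        rw [Summable.tsum_finsetSum fun i _ => summable_sum fun j _ => hF i j]
        exact Finset.sum_congr rfl fun i _ => (Summable.tsum_finsetSum fun j _ => hF i j).symm
    _ ≤ ∑' p : ℤ, |(p : ℝ)| * ‖symbolCoeff a p‖ * S := by
        refine Summable.tsum_le_tsum (fun p => ?_)
          (summable_sum fun i _ => summable_sum fun j _ => hF i j) (hsa'.mul_right S)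
        have h1 (i : Fin n) : ∑ j, F i j p ≤
            if (i : ℤ) - p ∉ Finset.Ico (0 : ℤ) n then ‖symbolCoeff a p‖ * S else 0 := by
          simp only [F]
          by_cases h : (i : ℤ) - p ∈ Finset.Ico (0 : ℤ) n
          · simp only [h, if_true, not_true_eq_false, if_false, Finset.sum_const_zero, le_refl]
          · simp only [h, if_false, not_false_eq_true, if_true, ← Finset.mul_sum]
            gcongr
            exact hcol i p
        refine (Finset.sum_le_sum fun i _ => h1 i).trans ?_
        rw [← Finset.sum_filter, Finset.sum_const, nsmul_eq_mul, mul_assoc]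
        gcongr
        calc _ ≤ ((p.natAbs : ℕ) : ℝ) := by exact_mod_cast card_filter_sub_notMem_le n p
          _ = _ := by simp
    _ = _ := tsum_mul_right

/-! ### Products of Toeplitz matrices and their inverses -/

/-- A positive smooth `2π`-periodic function on the real line. -/
structure IsPosSmoothSymbol (g : ℝ → ℝ) : Prop where
  periodic : Function.Periodic g (2 * Real.pi)
  contDiff : ContDiff ℝ ∞ g
  pos : ∀ θ, 0 < g θ

namespace IsPosSmoothSymbol

variable {g h : ℝ → ℝ}

theorem one : IsPosSmoothSymbol fun _ => 1 :=
  ⟨fun _ => rfl, contDiff_const, fun _ => one_pos⟩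

theorem mul (hg : IsPosSmoothSymbol g) (hh : IsPosSmoothSymbol h) :
    IsPosSmoothSymbol fun θ => g θ * h θ :=
  ⟨hg.periodic.mul hh.periodic, hg.contDiff.mul hh.contDiff,
    fun θ => mul_pos (hg.pos θ) (hh.pos θ)⟩

theorem inv (hg : IsPosSmoothSymbol g) : IsPosSmoothSymbol fun θ => (g θ)⁻¹ :=
  ⟨fun θ => by simp only [hg.periodic θ], hg.contDiff.inv fun θ => (hg.pos θ).ne',
    fun θ => inv_pos.2 (hg.pos θ)⟩

theorem exists_le (hg : IsPosSmoothSymbol g) : ∃ M, 0 < M ∧ ∀ θ, g θ ≤ M := by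
  obtain ⟨M, hM⟩ := exists_norm_le_of_periodic hg.periodic hg.contDiff.continuous
  have h (θ : ℝ) : g θ ≤ M := (le_abs_self _).trans (hM θ)
  exact ⟨M, (hg.pos 0).trans_le (h 0), h⟩

theorem exists_pos_le (hg : IsPosSmoothSymbol g) : ∃ δ, 0 < δ ∧ ∀ θ, δ ≤ g θ := by
  -- a bound on `g⁻¹` is used in place of the minimum of `g`
  obtain ⟨M, hM, h⟩ := hg.inv.exists_le
  exact ⟨M⁻¹, inv_pos.2 hM, fun θ => inv_le_of_inv_le₀ (hg.pos θ) (h θ)⟩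

theorem isUnit_toeplitzMatrix (hg : IsPosSmoothSymbol g) (n : ℕ) :
    IsUnit (toeplitzMatrix n fun θ => (g θ : ℂ)) := by
  obtain ⟨δ, hδ, h⟩ := hg.exists_pos_le
  exact (isUnit_toeplitzMatrix_and_norm_inv_le n hg.contDiff.continuous hδ h).1

theorem opNormBounded (hg : IsPosSmoothSymbol g) :
    OpNormBounded fun n => toeplitzMatrix n fun θ => (g θ : ℂ) := by
  obtain ⟨M, hM, h⟩ := hg.exists_le
  exact ⟨M, hM.le, fun n =>
    norm_toeplitzMatrix_le n hg.contDiff.continuous (fun θ => (hg.pos θ).le) h⟩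

theorem opNormBounded_inv (hg : IsPosSmoothSymbol g) :
    OpNormBounded fun n => (toeplitzMatrix n fun θ => (g θ : ℂ))⁻¹ := by
  obtain ⟨δ, hδ, h⟩ := hg.exists_pos_le
  exact ⟨δ⁻¹, (inv_pos.2 hδ).le, fun n =>
    (isUnit_toeplitzMatrix_and_norm_inv_le n hg.contDiff.continuous hδ h).2⟩

theorem traceNormBounded_mul_sub (hg : IsPosSmoothSymbol g) (hh : IsPosSmoothSymbol h) :
    TraceNormBounded fun n => toeplitzMatrix n (fun θ => ((g θ * h θ : ℝ) : ℂ)) -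
      toeplitzMatrix n (fun θ => (g θ : ℂ)) * toeplitzMatrix n (fun θ => (h θ : ℂ)) := by
  simp only [Complex.ofReal_mul]
  exact traceNormBounded_toeplitzMatrix_mul_sub (fun θ => by simp only [hg.periodic θ])
    (Complex.ofRealCLM.contDiff.comp hg.contDiff) (fun θ => by simp only [hh.periodic θ])
    (Complex.ofRealCLM.contDiff.comp hh.contDiff)

/-- `T_n(g)⁻¹ - T_n(g⁻¹) = T_n(g)⁻¹ (T_n(1) - T_n(g) T_n(g⁻¹))`. -/
theorem traceNormBounded_inv_sub (hg : IsPosSmoothSymbol g) :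
    TraceNormBounded fun n => (toeplitzMatrix n (fun θ => (g θ : ℂ)))⁻¹ -
      toeplitzMatrix n (fun θ => ((g θ)⁻¹ : ℝ) : ℝ → ℂ) := by
  convert! (hg.traceNormBounded_mul_sub hg.inv).mul_left hg.opNormBounded_inv using 2 with n
  have h1 : (fun θ => ((g θ * (g θ)⁻¹ : ℝ) : ℂ)) = fun _ => 1 := by
    ext θ
    rw [mul_inv_cancel₀ (hg.pos θ).ne', Complex.ofReal_one]
  have hdet := (Matrix.isUnit_iff_isUnit_det _).1 (hg.isUnit_toeplitzMatrix n)
  rw [h1, toeplitzMatrix_const, map_one, mul_sub, mul_one,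
    Matrix.nonsing_inv_mul_cancel_left _ _ hdet]

theorem zpow (hg : IsPosSmoothSymbol g) {e : ℤ} (he : e = 1 ∨ e = -1) :
    IsPosSmoothSymbol fun θ => g θ ^ e := by
  rcases he with rfl | rfl
  · simpa only [zpow_one] using hg
  · simpa only [zpow_neg_one] using hg.inv

theorem opNormBounded_zpow (hg : IsPosSmoothSymbol g) {e : ℤ} (he : e = 1 ∨ e = -1) :
    OpNormBounded fun n => toeplitzMatrix n (fun θ => (g θ : ℂ)) ^ e := by
  rcases he with rfl | rfl
  · simpa only [zpow_one] using hg.opNormBounded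
  · simpa only [Matrix.zpow_neg_one] using hg.opNormBounded_inv

theorem traceNormBounded_zpow_sub (hg : IsPosSmoothSymbol g) {e : ℤ} (he : e = 1 ∨ e = -1) :
    TraceNormBounded fun n => toeplitzMatrix n (fun θ => (g θ : ℂ)) ^ e -
      toeplitzMatrix n (fun θ => ((g θ ^ e : ℝ) : ℂ)) := by
  rcases he with rfl | rfl
  · simpa only [zpow_one, sub_self] using TraceNormBounded.zero
  · simpa only [Matrix.zpow_neg_one, zpow_neg_one] using hg.traceNormBounded_inv_sub

end IsPosSmoothSymbol

/-- The product of the `T_n(f_j)^{ε_j}` differs from the Toeplitz matrix of the product symbol by a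
sequence bounded in trace norm. -/
theorem isPosSmoothSymbol_and_traceNormBounded_prod (m : ℕ) (f : Fin m → ℝ → ℝ) (ε : Fin m → ℤ)
    (hf : ∀ j, IsPosSmoothSymbol (f j)) (hε : ∀ j, ε j = 1 ∨ ε j = -1) :
    IsPosSmoothSymbol (fun θ => ∏ j, f j θ ^ ε j) ∧
    TraceNormBounded fun n =>
      (List.ofFn fun j : Fin m => toeplitzMatrix n (fun θ => (f j θ : ℂ)) ^ ε j).prod -
        toeplitzMatrix n (fun θ => ((∏ j, f j θ ^ ε j : ℝ) : ℂ)) := by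
  induction m with
  | zero =>
    refine ⟨by simpa using IsPosSmoothSymbol.one, ?_⟩
    convert! TraceNormBounded.zero using 2 with n
    simp [toeplitzMatrix_const]
  | succ m ih =>
    obtain ⟨hG, hT⟩ := ih (fun j => f j.succ) (fun j => ε j.succ) (fun j => hf _) fun j => hε _
    have hg := (hf 0).zpow (hε 0)
    simp only [Fin.prod_univ_succ, List.ofFn_succ, List.prod_cons]
    refine ⟨hg.mul hG, ?_⟩
    -- `A P - T(gG) = A (P - T(G)) + (A - T(g)) T(G) - (T(gG) - T(g) T(G))`
    convert! ((hT.mul_left ((hf 0).opNormBounded_zpow (hε 0))).add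
      (((hf 0).traceNormBounded_zpow_sub (hε 0)).mul_right hG.opNormBounded)).add
      (hg.traceNormBounded_mul_sub hG).neg using 2 with n
    noncomm_ring

theorem mainTheorem3 (m : ℕ) (f : Fin m → ℝ → ℝ) (ε : Fin m → ℤ)
    (hf_periodic : ∀ j, Function.Periodic (f j) (2 * Real.pi))
    (hf_smooth : ∀ j, ContDiff ℝ ∞ (f j))
    (hf_pos : ∀ j θ, 0 < f j θ)
    (hε : ∀ j, ε j = 1 ∨ ε j = -1) :
    (∀ (n : ℕ) (j : Fin m), IsUnit (toeplitzMatrix n (fun θ => (f j θ : ℂ)))) ∧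
    Asymptotics.IsBigO Filter.atTop
      (fun n : ℕ =>
        Matrix.trace
            (List.ofFn fun j : Fin m => toeplitzMatrix n (fun θ => (f j θ : ℂ)) ^ ε j).prod
          - (((n : ℝ) / (2 * Real.pi) *
              ∫ θ in (0 : ℝ)..(2 * Real.pi), ∏ j : Fin m, f j θ ^ ε j : ℝ) : ℂ))
      (fun _ : ℕ => (1 : ℝ)) := by
  have hf (j : Fin m) : IsPosSmoothSymbol (f j) := ⟨hf_periodic j, hf_smooth j, hf_pos j⟩
  refine ⟨fun n j => (hf j).isUnit_toeplitzMatrix n, ?_⟩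
  obtain ⟨C, hC⟩ :=
    (isPosSmoothSymbol_and_traceNormBounded_prod m f ε hf hε).2.exists_norm_trace_le
  refine Asymptotics.IsBigO.of_bound C (Filter.Eventually.of_forall fun n => ?_)
  rw [norm_one, mul_one]
  convert! hC n using 2
  rw [Matrix.trace_sub, trace_toeplitzMatrix]
  congr 1
  simp only [symbolCoeff, Int.cast_zero, mul_zero, zero_mul, neg_zero, Complex.exp_zero, mul_one,
    intervalIntegral.integral_ofReal]
  push_cast
  ring
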